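/- For integers $n\ge 1$ and $k\ge 0$ let $N(n,k)=\frac1n\binom{n}{k}\binom{n}{k+1}$ be the Narayana numbers, with the convention $N(0,0)=1$ and $N(0,k)=0$ for $k\ge 1$. Call a sequence $(x_m)_{m\ge 0}$ of real numbers log-convex if $x_m^2\le x_{m+1}x_{m-1}$ for all $m\ge 1$. If $(a_k)_{k\ge 0}$ is a log-convex sequence of positive real numbers, then its Narayana transform $$b_n=\sum_{k=0}^n N(n,k)\,a_k,\qquad n\ge 0,$$ is log-convex. -/

import Mathlib

/-- The Narayana number `N(n, k) = (1 / n) * C(n, k) * C(n, k + 1)` for `n ≥ 1`.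
For `n = 0`, where the quotient is undefined, the usual convention
`N(0, 0) = 1` and `N(0, k) = 0` for `k ≥ 1` is used. -/
noncomputable def narayanaNumber (n k : ℕ) : ℝ :=
  if n = 0 then (if k = 0 then 1 else 0)
  else (1 / (n : ℝ)) * (n.choose k : ℝ) * (n.choose (k + 1) : ℝ)

/-- The Narayana transform `b_n = ∑_{k=0}^n N(n, k) a_k` of a real sequence `a`. -/
noncomputable def narayanaTransform (a : ℕ → ℝ) (n : ℕ) : ℝ :=
  ∑ k ∈ Finset.range (n + 1), narayanaNumber n k * a k

/-- A real sequence `(a_m)_{m ≥ 0}` is log-convex if `a_m ^ 2 ≤ a_{m+1} a_{m-1}` for all `m ≥ 1`. -/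
def IsLogConvexSeq (a : ℕ → ℝ) : Prop :=
  ∀ m : ℕ, 1 ≤ m → a m ^ 2 ≤ a (m + 1) * a (m - 1)

/-!
With `N_n = ∑ k, N(n, k) X ^ k`, the claim `b_m ^ 2 ≤ b_{m+1} b_{m-1}` for `m ≥ 2` rests on two facts
about the numbers `β(k, j) = N(m+1, k) N(m-1, j) - N(m, k) N(m, j)`.

* The sum of `β` over every antidiagonal `k + j = r` is nonnegative, that is, `N_{m+1} N_{m-1} - N_m ^ 2`
  has nonnegative coefficients (`narayanaPoly_coeff_nonneg`). Indeed `N_{n+1}` is the generating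
  polynomial of Motzkin paths of length `n` with level steps of weight `1 + X` and down steps of
  weight `X`. The paths ending at a given height are counted by `motzkinPoly`, whose rows are obtained
  from each other by a tridiagonal matrix. All `2 × 2` minors of that matrix have nonnegative
  coefficients, since `(1 + X) ^ 2 - X` has, and the property passes to minors of consecutive rows
  (`coeffNonneg_motzkinMinor`).

* On an antidiagonal the symmetrized numbers `γ(k, j) = β(k, j) + β(j, k)` change sign at most once
  from the outside towards the centre (`narayanaGap_nonpos_of_neg`): up to a positive factor `γ` is
  a decreasing function of the product `(m - k) (m - j)`.

For a positive log-convex sequence the products `a_k a_j` decrease towards the centre of an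
antidiagonal, so the positive values of `γ` carry the larger products, and the weighted sums
`∑ γ(k, j) a_k a_j` are bounded below by a nonnegative multiple of `∑ γ(k, j)`. For `m = 1` the claim
is the inequality `a_0 ^ 2 ≤ a_0 (a_0 + a_1)`.
-/

open Finset.HasAntidiagonal (antidiagonal)

open Polynomial in
/-- A real polynomial all of whose coefficients are nonnegative. -/
def CoeffNonneg (p : ℝ[X]) : Prop := ∀ i, 0 ≤ p.coeff i

namespace CoeffNonneg

open Polynomial

variable {p q : ℝ[X]}

lemma zero : CoeffNonneg 0 := fun i => by simp

lemma one : CoeffNonneg 1 := fun i => by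
  rw [coeff_one]
  split_ifs <;> norm_num

lemma X : CoeffNonneg X := fun i => by
  rw [coeff_X]
  split_ifs <;> norm_num

lemma add (hp : CoeffNonneg p) (hq : CoeffNonneg q) : CoeffNonneg (p + q) := fun i => by
  rw [coeff_add]
  exact add_nonneg (hp i) (hq i)

lemma mul (hp : CoeffNonneg p) (hq : CoeffNonneg q) : CoeffNonneg (p * q) := fun i => by
  rw [coeff_mul]
  exact Finset.sum_nonneg fun x _ => mul_nonneg (hp _) (hq _)

end CoeffNonneg

/-! ### Weighted Motzkin paths -/

section Motzkin

open Polynomial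

/-- The generating polynomial of Motzkin paths with `n` steps from height `0` to height `k - 1`, with
up steps of weight `1`, level steps of weight `1 + X` and down steps of weight `X`. The height is
shifted by one so that the column `k = 0`, which vanishes, is the wall below height `0`. -/
noncomputable def motzkinPoly : ℕ → ℕ → ℝ[X]
  | 0, k => if k = 1 then 1 else 0
  | _ + 1, 0 => 0
  | n + 1, k + 1 => motzkinPoly n k + (1 + X) * motzkinPoly n (k + 1) + X * motzkinPoly n (k + 2)

lemma motzkinPoly_zero_left (k : ℕ) : motzkinPoly 0 k = if k = 1 then 1 else 0 := by
  simp [motzkinPoly]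

lemma motzkinPoly_zero_right (n : ℕ) : motzkinPoly n 0 = 0 := by
  cases n <;> simp [motzkinPoly]

lemma motzkinPoly_succ_succ (n k : ℕ) : motzkinPoly (n + 1) (k + 1) =
    motzkinPoly n k + (1 + X) * motzkinPoly n (k + 1) + X * motzkinPoly n (k + 2) := by
  rw [motzkinPoly]

lemma coeffNonneg_motzkinPoly (n k : ℕ) : CoeffNonneg (motzkinPoly n k) := by
  induction n generalizing k with
  | zero =>
    rw [motzkinPoly_zero_left]
    split_ifs
    exacts [CoeffNonneg.one, CoeffNonneg.zero]
  | succ n ih =>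
    cases k with
    | zero => rw [motzkinPoly_zero_right]; exact CoeffNonneg.zero
    | succ k =>
      rw [motzkinPoly_succ_succ]
      exact ((ih _).add ((CoeffNonneg.one.add CoeffNonneg.X).mul (ih _))).add
        (CoeffNonneg.X.mul (ih _))

/-- The `2 × 2` minor of rows `n`, `n + 1` and columns `k`, `l` of the array `motzkinPoly`. -/
noncomputable def motzkinMinor (n k l : ℕ) : ℝ[X] :=
  motzkinPoly n k * motzkinPoly (n + 1) l - motzkinPoly n l * motzkinPoly (n + 1) k

lemma motzkinMinor_zero_left (n l : ℕ) : motzkinMinor n 0 l = 0 := by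
  simp [motzkinMinor, motzkinPoly_zero_right]

/-- The Cauchy–Binet expansion of the next minor, the tridiagonal structure leaving nine terms. -/
lemma motzkinMinor_succ (n k l : ℕ) : motzkinMinor (n + 1) (k + 1) (l + 1) =
    motzkinMinor n k l + (1 + X) * motzkinMinor n k (l + 1) + X * motzkinMinor n k (l + 2)
    + (1 + X) * motzkinMinor n (k + 1) l + (1 + X) * (1 + X) * motzkinMinor n (k + 1) (l + 1)
    + (1 + X) * X * motzkinMinor n (k + 1) (l + 2) + X * motzkinMinor n (k + 2) l
    + (1 + X) * X * motzkinMinor n (k + 2) (l + 1) + X * X * motzkinMinor n (k + 2) (l + 2) := by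
  simp only [motzkinMinor, motzkinPoly_succ_succ (n + 1)]
  rw [motzkinPoly_succ_succ n k, motzkinPoly_succ_succ n l]
  ring

lemma motzkinMinor_self (n k : ℕ) : motzkinMinor n k k = 0 := by
  simp [motzkinMinor]

lemma motzkinMinor_swap (n k l : ℕ) : motzkinMinor n k l = -motzkinMinor n l k := by
  simp [motzkinMinor]

lemma coeffNonneg_motzkinMinor (n : ℕ) {k l : ℕ} (hkl : k ≤ l) :
    CoeffNonneg (motzkinMinor n k l) := by
  induction n generalizing k l with
  | zero =>
    rcases hkl.eq_or_lt with rfl | hlt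
    · rw [motzkinMinor_self]; exact CoeffNonneg.zero
    rcases Nat.eq_zero_or_pos k with rfl | hk
    · rw [motzkinMinor_zero_left]; exact CoeffNonneg.zero
    have hl : motzkinPoly 0 l = 0 := by
      rw [motzkinPoly_zero_left, if_neg (by omega)]
    rw [motzkinMinor, hl, zero_mul, sub_zero]
    exact (coeffNonneg_motzkinPoly _ _).mul (coeffNonneg_motzkinPoly _ _)
  | succ n ih =>
    rcases hkl.eq_or_lt with rfl | hlt
    · rw [motzkinMinor_self]; exact CoeffNonneg.zero
    cases k with
    | zero => rw [motzkinMinor_zero_left]; exact CoeffNonneg.zero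
    | succ k =>
      obtain ⟨l, rfl⟩ : ∃ l', l = l' + 1 := ⟨l - 1, by omega⟩
      have hX := CoeffNonneg.X
      have hs := CoeffNonneg.one.add CoeffNonneg.X
      rcases (show k + 1 ≤ l by omega).eq_or_lt with rfl | hl
      · -- For adjacent columns one of the nine minors is reversed; it is absorbed by the central
        -- one, as `(1 + X) ^ 2 - X = 1 + X + X ^ 2`.
        have e : motzkinMinor (n + 1) (k + 1) (k + 1 + 1) =
            motzkinMinor n k (k + 1) + (1 + X) * motzkinMinor n k (k + 2)
            + X * motzkinMinor n k (k + 3)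
            + (1 + X + X * X) * motzkinMinor n (k + 1) (k + 2)
            + (1 + X) * X * motzkinMinor n (k + 1) (k + 3)
            + X * X * motzkinMinor n (k + 2) (k + 3) := by
          rw [motzkinMinor_succ, motzkinMinor_self, motzkinMinor_self,
            motzkinMinor_swap n (k + 2) (k + 1)]
          ring
        rw [e]
        exact (((((ih (by omega)).add (hs.mul (ih (by omega)))).add (hX.mul (ih (by omega)))).add
          ((hs.add (hX.mul hX)).mul (ih (by omega)))).add
          ((hs.mul hX).mul (ih (by omega)))).add ((hX.mul hX).mul (ih (by omega)))
      · rw [motzkinMinor_succ]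
        exact ((((((((ih (by omega)).add (hs.mul (ih (by omega)))).add
          (hX.mul (ih (by omega)))).add (hs.mul (ih (by omega)))).add
          ((hs.mul hs).mul (ih (by omega)))).add ((hs.mul hX).mul (ih (by omega)))).add
          (hX.mul (ih (by omega)))).add ((hs.mul hX).mul (ih (by omega)))).add
          ((hX.mul hX).mul (ih (by omega)))

lemma motzkinPoly_coeff_zero (n k : ℕ) : (motzkinPoly n (k + 1)).coeff 0 = n.choose k := by
  induction n generalizing k with
  | zero => cases k <;> simp [motzkinPoly_zero_left]
  | succ n ih =>
    rw [motzkinPoly_succ_succ]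
    cases k with
    | zero => simp [mul_coeff_zero, motzkinPoly_zero_right, ih]
    | succ k => simp [mul_coeff_zero, ih, Nat.choose_succ_succ]

/-- The reflection formula: Motzkin paths of this kind encode pairs of lattice paths, and the
nonintersecting ones are counted by a `2 × 2` determinant of binomial coefficients. -/
lemma motzkinPoly_coeff_succ (n k i : ℕ) : (motzkinPoly n (k + 1)).coeff (i + 1) =
    (n.choose (i + 1) : ℝ) * n.choose (i + 1 + k) - n.choose i * n.choose (i + k + 2) := by
  induction n generalizing k i with
  | zero =>
    rw [motzkinPoly_zero_left]
    split_ifs <;> simp [coeff_one]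
  | succ n ih =>
    have e : (motzkinPoly (n + 1) (k + 1)).coeff (i + 1) =
        (motzkinPoly n k).coeff (i + 1) + (motzkinPoly n (k + 1)).coeff (i + 1)
        + (motzkinPoly n (k + 1)).coeff i + (motzkinPoly n (k + 2)).coeff i := by
      rw [motzkinPoly_succ_succ, add_mul, one_mul, coeff_add, coeff_add, coeff_add,
        coeff_X_mul, coeff_X_mul]
      ring
    have hk : (motzkinPoly n k).coeff (i + 1) =
        (n.choose (i + 1) : ℝ) * n.choose (i + k) - n.choose i * n.choose (i + k + 1) := by
      cases k with
      | zero => simp [motzkinPoly_zero_right, mul_comm]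
      | succ k =>
        rw [ih]
        ring_nf
    rw [e, hk, ih]
    have c1 : i + 1 + k = (i + k) + 1 := by ring
    cases i with
    | zero =>
      rw [motzkinPoly_coeff_zero, motzkinPoly_coeff_zero, c1]
      simp only [Nat.choose_succ_succ, Nat.choose_zero_right, Nat.succ_eq_add_one]
      push_cast
      simp only [zero_add]
      ring
    | succ i =>
      rw [ih, ih, c1]
      have c2 : i + 1 + (k + 1) = i + 1 + k + 1 := by ring
      have c3 : i + (k + 1) + 2 = i + 1 + k + 2 := by ring
      have c4 : i + k + 2 = i + 1 + k + 1 := by ring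
      rw [c2, c3, c4, Nat.choose_succ_succ' n (i + 1), Nat.choose_succ_succ' n i,
        Nat.choose_succ_succ' n (i + 1 + k), Nat.choose_succ_succ' n (i + 1 + k + 1)]
      push_cast
      ring_nf

end Motzkin

/-! ### Narayana numbers -/

lemma narayanaNumber_nonneg (n k : ℕ) : 0 ≤ narayanaNumber n k := by
  unfold narayanaNumber
  split_ifs <;> positivity

lemma narayanaNumber_pos {n k : ℕ} (h : k < n) : 0 < narayanaNumber n k := by
  have h1 := Nat.choose_pos h.le
  have h2 := Nat.choose_pos (show k + 1 ≤ n from h)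
  have h3 : 0 < n := by omega
  rw [narayanaNumber, if_neg h3.ne']
  positivity

lemma narayanaNumber_eq_zero {n k : ℕ} (hn : n ≠ 0) (h : n ≤ k) : narayanaNumber n k = 0 := by
  rw [narayanaNumber, if_neg hn, Nat.choose_eq_zero_of_lt (show n < k + 1 by omega)]
  simp

lemma narayanaNumber_succ_mul (n k : ℕ) (h : k ≤ n) :
    narayanaNumber (n + 1) k * ((n + 1 - k) * (n - k)) = narayanaNumber n k * (n * (n + 1)) := by
  rcases Nat.eq_zero_or_pos n with rfl | hn
  · obtain rfl : k = 0 := by omega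
    simp
  have h1 : (n.choose k : ℝ) * (n + 1) = (n + 1).choose k * (n + 1 - k) := by
    have := Nat.choose_mul_succ_eq n k
    rw [← Nat.cast_inj (R := ℝ)] at this
    push_cast [Nat.cast_sub (show k ≤ n + 1 by omega)] at this
    exact this
  have h2 : (n.choose (k + 1) : ℝ) * (n + 1) = (n + 1).choose (k + 1) * (n - k) := by
    have := Nat.choose_mul_succ_eq n (k + 1)
    rw [← Nat.cast_inj (R := ℝ)] at this
    rw [Nat.add_sub_add_right] at this
    push_cast [Nat.cast_sub h] at this
    exact this
  have hn' : (n : ℝ) ≠ 0 := by positivity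
  rw [narayanaNumber, narayanaNumber, if_neg (by omega), if_neg (by omega)]
  push_cast
  calc _ = 1 / ((n : ℝ) + 1) * (((n + 1).choose k * (n + 1 - k))
          * ((n + 1).choose (k + 1) * (n - k))) := by ring
    _ = _ := by
      rw [← h1, ← h2]
      field_simp

lemma motzkinPoly_one_coeff (n i : ℕ) :
    (motzkinPoly n 1).coeff i = narayanaNumber (n + 1) i := by
  cases i with
  | zero =>
    rw [motzkinPoly_coeff_zero n 0, narayanaNumber, if_neg (by omega)]
    have : (n : ℝ) + 1 ≠ 0 := by positivity
    simp [this]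
  | succ i =>
    rw [motzkinPoly_coeff_succ n 0, narayanaNumber, if_neg (by omega)]
    have h1 : (n.choose (i + 1) : ℝ) * (i + 1) = n.choose i * (n - i) := by
      rcases le_or_gt i n with h | h
      · have := Nat.choose_succ_right_eq n i
        rw [← Nat.cast_inj (R := ℝ)] at this
        push_cast [Nat.cast_sub h] at this
        exact this
      · simp [Nat.choose_eq_zero_of_lt h, Nat.choose_eq_zero_of_lt (show n < i + 1 by omega)]
    have h2 : (n.choose (i + 2) : ℝ) * (i + 2) = n.choose (i + 1) * (n - i - 1) := by
      rcases le_or_gt (i + 1) n with h | h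
      · have := Nat.choose_succ_right_eq n (i + 1)
        rw [← Nat.cast_inj (R := ℝ)] at this
        push_cast [Nat.cast_sub h] at this
        linear_combination this
      · simp [Nat.choose_eq_zero_of_lt h, Nat.choose_eq_zero_of_lt (show n < i + 2 by omega)]
    have h3 : ((n + 1).choose (i + 1 + 1) : ℝ) * (i + 2) = (n + 1) * n.choose (i + 1) := by
      have := Nat.add_one_mul_choose_eq n (i + 1)
      rw [← Nat.cast_inj (R := ℝ)] at this
      push_cast at this
      linear_combination -this
    have h4 : ((n + 1).choose (i + 1) : ℝ) = n.choose i + n.choose (i + 1) := by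
      rw [Nat.choose_succ_succ]
      push_cast
      rfl
    have hi : (i : ℝ) + 2 ≠ 0 := by positivity
    have hn : (n : ℝ) + 1 ≠ 0 := by positivity
    have h5 : ((n + 1).choose (i + 1 + 1) : ℝ) = (n + 1) * n.choose (i + 1) / (i + 2) := by
      rw [eq_div_iff hi, h3]
    rw [h5, h4]
    push_cast
    simp only [add_zero]
    field_simp
    linear_combination (-(n.choose i : ℝ)) * h2 + (n.choose (i + 1) : ℝ) * h1

/-- The coefficients of `N_{m+1} N_{m-1} - N_m ^ 2` are nonnegative, for `m = n + 2`. -/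
lemma narayanaPoly_coeff_nonneg (n r : ℕ) :
    0 ≤ ∑ x ∈ antidiagonal r,
      (narayanaNumber (n + 3) x.1 * narayanaNumber (n + 1) x.2
        - narayanaNumber (n + 2) x.1 * narayanaNumber (n + 2) x.2) := by
  open Polynomial in
  -- Expanding the row `n + 2` in column `1` turns this into a minor of rows `n` and `n + 1`.
  have key : motzkinPoly (n + 2) 1 * motzkinPoly n 1 - motzkinPoly (n + 1) 1 * motzkinPoly (n + 1) 1
      = X * motzkinMinor n 1 2 := by
    rw [motzkinMinor, motzkinPoly_succ_succ (n + 1) 0, motzkinPoly_zero_right]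
    have := motzkinPoly_succ_succ n 0
    rw [motzkinPoly_zero_right] at this
    simp only [zero_add] at this ⊢
    linear_combination (-motzkinPoly (n + 1) 1) * this
  have h := (CoeffNonneg.X.mul (coeffNonneg_motzkinMinor n (show 1 ≤ 2 by norm_num))) r
  rw [← key, Polynomial.coeff_sub, Polynomial.coeff_mul, Polynomial.coeff_mul,
    ← Finset.sum_sub_distrib] at h
  simpa only [motzkinPoly_one_coeff] using h

/-! ### The sign pattern on an antidiagonal -/

/-- The symmetrized coefficient `γ(k, j)`, for `m = n + 2`: the sum of `γ(k, j) a_k a_j` over all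
ordered pairs `(k, j)` is `2 (b_{m+1} b_{m-1} - b_m ^ 2)`. -/
noncomputable def narayanaGap (n k j : ℕ) : ℝ :=
  narayanaNumber (n + 3) k * narayanaNumber (n + 1) j
    + narayanaNumber (n + 3) j * narayanaNumber (n + 1) k
    - 2 * (narayanaNumber (n + 2) k * narayanaNumber (n + 2) j)

lemma narayanaGap_mul {n k j : ℕ} (hk : k < n + 2) (hj : j < n + 2) {u v : ℝ}
    (hu : u = n + 2 - k) (hv : v = n + 2 - j) :
    narayanaGap n k j * ((n + 1) * (u * (u + 1) * (v * (v + 1)))) =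
      narayanaNumber (n + 2) k * narayanaNumber (n + 2) j *
        ((n + 3) * (u ^ 2 * (u ^ 2 - 1) + v ^ 2 * (v ^ 2 - 1))
          - 2 * (n + 1) * (u * (u + 1) * (v * (v + 1)))) := by
  have k1 := narayanaNumber_succ_mul (n + 2) k (by omega)
  have j1 := narayanaNumber_succ_mul (n + 2) j (by omega)
  have k0 := narayanaNumber_succ_mul (n + 1) k (by omega)
  have j0 := narayanaNumber_succ_mul (n + 1) j (by omega)
  push_cast at k0 k1 j0 j1
  have hk' : (k : ℝ) = n + 2 - u := by rw [hu]; ring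
  have hj' : (j : ℝ) = n + 2 - v := by rw [hv]; ring
  rw [hk'] at k0 k1
  rw [hj'] at j0 j1
  have hn : (n : ℝ) + 2 ≠ 0 := by positivity
  unfold narayanaGap
  simp only [add_assoc] at *
  norm_num at *
  have k1' : narayanaNumber (n + 3) k * (u * (u + 1))
      = narayanaNumber (n + 2) k * ((n + 2) * (n + 3)) := by linear_combination k1
  have j1' : narayanaNumber (n + 3) j * (v * (v + 1))
      = narayanaNumber (n + 2) j * ((n + 2) * (n + 3)) := by linear_combination j1
  have k0' : narayanaNumber (n + 1) k * ((n + 1) * (n + 2))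
      = narayanaNumber (n + 2) k * (u * (u - 1)) := by linear_combination -k0
  have j0' : narayanaNumber (n + 1) j * ((n + 1) * (n + 2))
      = narayanaNumber (n + 2) j * (v * (v - 1)) := by linear_combination -j0
  refine mul_right_cancel₀ hn ?_
  linear_combination
    (narayanaNumber (n + 1) j * ((n + 1) * (n + 2)) * (v * (v + 1))) * k1'
    + (narayanaNumber (n + 2) k * ((n + 2) * (n + 3)) * (v * (v + 1))) * j0'
    + (narayanaNumber (n + 1) k * ((n + 1) * (n + 2)) * (u * (u + 1))) * j1'
    + (narayanaNumber (n + 2) j * ((n + 2) * (n + 3)) * (u * (u + 1))) * k0'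

/-- The bracket in `narayanaGap_mul` decreases when the product `u v` grows and `u + v` is fixed. -/
lemma gapPolynomial_anti {c u v u' v' : ℝ} (hc : 0 ≤ c) (hu : 1 ≤ u) (hv : 1 ≤ v)
    (hs : u' + v' = u + v) (hp : u * v ≤ u' * v') :
    (c + 3) * (u' ^ 2 * (u' ^ 2 - 1) + v' ^ 2 * (v' ^ 2 - 1))
        - 2 * (c + 1) * (u' * (u' + 1) * (v' * (v' + 1))) ≤
      (c + 3) * (u ^ 2 * (u ^ 2 - 1) + v ^ 2 * (v ^ 2 - 1))
        - 2 * (c + 1) * (u * (u + 1) * (v * (v + 1))) := by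
  obtain ⟨s, hs'⟩ : ∃ s, s = u + v := ⟨_, rfl⟩
  have hv1 : v = s - u := by linarith
  have hv1' : v' = s - u' := by linarith
  obtain ⟨p, hp'⟩ : ∃ p, p = u * v := ⟨_, rfl⟩
  obtain ⟨p', hp''⟩ : ∃ p', p' = u' * v' := ⟨_, rfl⟩
  have hs2 : 2 ≤ s := by linarith
  have hp4 : 4 * p' ≤ s ^ 2 := by
    rw [hp'', hv1']
    nlinarith [sq_nonneg (u' - (s - u'))]
  have hpp : p ≤ p' := by rw [hp', hp'']; exact hp
  have hp0 : 0 < p := by rw [hp']; positivity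
  have e : ∀ x y : ℝ, x + y = s → (c + 3) * (x ^ 2 * (x ^ 2 - 1) + y ^ 2 * (y ^ 2 - 1))
        - 2 * (c + 1) * (x * (x + 1) * (y * (y + 1))) =
      (c + 3) * (s ^ 4 - 4 * s ^ 2 * (x * y) + 2 * (x * y) ^ 2 - s ^ 2 + 2 * (x * y))
        - 2 * (c + 1) * ((x * y) * (x * y + s + 1)) := by
    rintro x y rfl
    ring
  rw [e u v hs'.symm, e u' v' (by linarith), ← hp', ← hp'']
  have f1 : 0 ≤ (p' - p) * (4 * s ^ 2 - 2 * (p + p') - 2) :=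
    mul_nonneg (by linarith) (by nlinarith)
  have f2 : 0 ≤ (p' - p) * (p + p' + s + 1) := mul_nonneg (by linarith) (by linarith)
  have f3 := mul_nonneg (show 0 ≤ c + 3 by linarith) f1
  have f4 := mul_nonneg (show 0 ≤ 2 * (c + 1) by linarith) f2
  linarith

lemma narayanaGap_comm (n k j : ℕ) : narayanaGap n k j = narayanaGap n j k := by
  unfold narayanaGap
  ring

lemma narayanaGap_nonneg_of_le {n k j : ℕ} (hj : n + 2 ≤ j) : 0 ≤ narayanaGap n k j := by
  rw [narayanaGap, narayanaNumber_eq_zero (by omega) hj, mul_zero, mul_zero, sub_zero]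
  have := narayanaNumber_nonneg
  exact add_nonneg (mul_nonneg (this _ _) (this _ _)) (mul_nonneg (this _ _) (this _ _))

/-- If `narayanaGap` is negative at `(k, j)`, it is nonpositive at all points of the same antidiagonal
that are closer to the centre. -/
lemma narayanaGap_nonpos_of_neg {n k j k' j' : ℕ} (h : narayanaGap n k j < 0) (hkj : k ≤ j)
    (hsum : k' + j' = k + j) (hk : k ≤ k') (hkj' : k' ≤ j') : narayanaGap n k' j' ≤ 0 := by
  have hj2 : j < n + 2 := by
    by_contra hj
    exact absurd h (not_lt.2 (narayanaGap_nonneg_of_le (not_lt.1 hj)))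
  have hj2' : j' < n + 2 := by omega
  have pos : ∀ i : ℕ, i < n + 2 → (1 : ℝ) ≤ n + 2 - i := fun i hi => by
    have : ((i + 1 : ℕ) : ℝ) ≤ ((n + 2 : ℕ) : ℝ) := Nat.cast_le.2 hi
    push_cast at this
    linarith
  have hu := pos k (by omega)
  have hv := pos j hj2
  have hu' := pos k' (by omega)
  have hv' := pos j' hj2'
  have hsum' : (k' : ℝ) + j' = k + j := by exact_mod_cast hsum
  have hkR : (k : ℝ) ≤ k' := by exact_mod_cast hk
  have hkjR : (k' : ℝ) ≤ j' := by exact_mod_cast hkj'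
  have hkjR0 : (k : ℝ) ≤ j' := hkR.trans hkjR
  have e := narayanaGap_mul (n := n) (k := k) (j := j) (by omega) hj2 rfl rfl
  have e' := narayanaGap_mul (n := n) (k := k') (j := j') (by omega) hj2' rfl rfl
  have hmono := gapPolynomial_anti (c := n) (Nat.cast_nonneg n) hu hv
    (u' := n + 2 - k') (v' := n + 2 - j') (by linarith) (by
      have hj : (j : ℝ) = k' + j' - k := by linarith
      rw [hj]
      nlinarith [mul_nonneg (sub_nonneg.2 hkR) (sub_nonneg.2 hkjR0)])
  have N1 : 0 < narayanaNumber (n + 2) k := narayanaNumber_pos (by omega)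
  have N2 : 0 < narayanaNumber (n + 2) j := narayanaNumber_pos hj2
  have N1' : 0 < narayanaNumber (n + 2) k' := narayanaNumber_pos (by omega)
  have N2' : 0 < narayanaNumber (n + 2) j' := narayanaNumber_pos hj2'
  generalize (n : ℝ) + 2 - k = u at *
  generalize (n : ℝ) + 2 - j = v at *
  generalize (n : ℝ) + 2 - k' = u' at *
  generalize (n : ℝ) + 2 - j' = v' at *
  have D : 0 < ((n : ℝ) + 1) * (u * (u + 1) * (v * (v + 1))) := by positivity
  have D' : 0 < ((n : ℝ) + 1) * (u' * (u' + 1) * (v' * (v' + 1))) := by positivity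
  have s1 := mul_neg_of_neg_of_pos h D
  rw [e] at s1
  have s2 := (pos_iff_neg_of_mul_neg s1).1 (mul_pos N1 N2)
  by_contra hcon
  have s3 := mul_pos (not_le.1 hcon) D'
  rw [e'] at s3
  have s4 := (pos_iff_pos_of_mul_pos s3).1 (mul_pos N1' N2')
  linarith

/-! ### Log-convex sequences -/

lemma IsLogConvexSeq.mul_succ_le {a : ℕ → ℝ} (ha : IsLogConvexSeq a) (hpos : ∀ k, 0 < a k)
    {k j : ℕ} (h : k ≤ j) : a (k + 1) * a j ≤ a k * a (j + 1) := by
  induction j, h using Nat.le_induction with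
  | base => rw [mul_comm]
  | succ j _ ih =>
    have h1 := ha (j + 1) (by omega)
    rw [Nat.add_sub_cancel] at h1
    refine le_of_mul_le_mul_right ?_ (hpos j)
    calc a (k + 1) * a (j + 1) * a j = (a (k + 1) * a j) * a (j + 1) := by ring
      _ ≤ (a k * a (j + 1)) * a (j + 1) := mul_le_mul_of_nonneg_right ih (hpos _).le
      _ = a k * a (j + 1) ^ 2 := by ring
      _ ≤ a k * (a (j + 1 + 1) * a j) := mul_le_mul_of_nonneg_left h1 (hpos _).le
      _ = _ := by ring

/-- The products `a_k a_j` decrease towards the centre of an antidiagonal. -/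
lemma IsLogConvexSeq.mul_le_mul {a : ℕ → ℝ} (ha : IsLogConvexSeq a) (hpos : ∀ k, 0 < a k)
    (d : ℕ) {k j : ℕ} (h : k + d ≤ j) : a (k + d) * a j ≤ a k * a (j + d) := by
  induction d generalizing j with
  | zero => simp
  | succ d ih =>
    calc a (k + (d + 1)) * a j ≤ a (k + d) * a (j + 1) :=
          ha.mul_succ_le hpos (k := k + d) (by omega)
      _ ≤ a k * a (j + 1 + d) := ih (by omega)
      _ = _ := by rw [add_assoc j, add_comm 1 d]

/-- A symmetric weight on an antidiagonal with nonnegative total, negative only towards the centre,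
gives a nonnegative sum against the products `a_k a_j` of a log-convex sequence. -/
lemma IsLogConvexSeq.sum_antidiagonal_nonneg {a : ℕ → ℝ} (ha : IsLogConvexSeq a)
    (hpos : ∀ k, 0 < a k) (γ : ℕ → ℕ → ℝ) (hsymm : ∀ k j, γ k j = γ j k)
    (hsign : ∀ k j k' j', γ k j < 0 → k ≤ j → k' + j' = k + j → k ≤ k' → k' ≤ j' → γ k' j' ≤ 0)
    (r : ℕ) (hsum : 0 ≤ ∑ x ∈ antidiagonal r, γ x.1 x.2) :
    0 ≤ ∑ x ∈ antidiagonal r, γ x.1 x.2 * (a x.1 * a x.2) := by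
  -- The threshold `T` is the product at the outermost point carrying a negative weight, which is
  -- the largest product with a negative weight.
  obtain ⟨T, hT, hle⟩ : ∃ T : ℝ, 0 ≤ T ∧ ∀ k j, k + j = r → k ≤ j →
      γ k j * T ≤ γ k j * (a k * a j) := by
    by_cases hneg : ∃ k j, k + j = r ∧ k ≤ j ∧ γ k j < 0
    · classical
      have hne : ∃ k, k ≤ r - k ∧ k ≤ r ∧ γ k (r - k) < 0 := by
        obtain ⟨k, j, hr, hkj, hlt⟩ := hneg
        obtain rfl : j = r - k := by omega
        exact ⟨k, hkj, by omega, hlt⟩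
      obtain ⟨h1, h1', h2⟩ := Nat.find_spec hne
      have hmin : ∀ m, m < Nat.find hne → ¬(m ≤ r - m ∧ m ≤ r ∧ γ m (r - m) < 0) :=
        fun m hm => Nat.find_min hne hm
      generalize Nat.find hne = k₀ at *
      refine ⟨a k₀ * a (r - k₀), (mul_pos (hpos _) (hpos _)).le, fun k j hr hkj => ?_⟩
      obtain rfl : j = r - k := by omega
      rcases lt_or_ge k k₀ with hk | hk
      · have hg : 0 ≤ γ k (r - k) := by
          by_contra hcon
          exact hmin k hk ⟨hkj, by omega, not_le.1 hcon⟩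
        refine mul_le_mul_of_nonneg_left ?_ hg
        have := ha.mul_le_mul hpos (k₀ - k) (k := k) (j := r - k₀) (by omega)
        rwa [show k + (k₀ - k) = k₀ by omega, show r - k₀ + (k₀ - k) = r - k by omega] at this
      · have hg : γ k (r - k) ≤ 0 := hsign _ _ _ _ h2 h1 (by omega) hk hkj
        refine mul_le_mul_of_nonpos_left ?_ hg
        have := ha.mul_le_mul hpos (k - k₀) (k := k₀) (j := r - k) (by omega)
        rwa [show k₀ + (k - k₀) = k by omega, show r - k + (k - k₀) = r - k₀ by omega] at this
    · refine ⟨0, le_rfl, fun k j hr hkj => ?_⟩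
      have hg : 0 ≤ γ k j := by
        by_contra hcon
        exact hneg ⟨k, j, hr, hkj, not_le.1 hcon⟩
      exact mul_le_mul_of_nonneg_left (mul_pos (hpos _) (hpos _)).le hg
  calc 0 ≤ (∑ x ∈ antidiagonal r, γ x.1 x.2) * T := mul_nonneg hsum hT
    _ = ∑ x ∈ antidiagonal r, γ x.1 x.2 * T := Finset.sum_mul _ _ _
    _ ≤ _ := Finset.sum_le_sum fun x hx => by
      rw [Finset.HasAntidiagonal.mem_antidiagonal] at hx
      rcases le_total x.1 x.2 with h | h
      · exact hle _ _ hx h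
      · rw [hsymm, mul_comm (a x.1)]
        exact hle _ _ (by omega) h

/-! ### The Narayana transform -/

open Polynomial in
/-- The polynomial `∑ k, N(n, k) a_k X ^ k`, whose value at `1` is the Narayana transform of `a`. -/
noncomputable def narayanaTransformPoly (a : ℕ → ℝ) (n : ℕ) : ℝ[X] :=
  ∑ k ∈ Finset.range (n + 1), monomial k (narayanaNumber n k * a k)

lemma narayanaTransformPoly_eval (a : ℕ → ℝ) (n : ℕ) :
    (narayanaTransformPoly a n).eval 1 = narayanaTransform a n := by
  simp [narayanaTransformPoly, narayanaTransform, Polynomial.eval_finsetSum]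

lemma narayanaTransformPoly_coeff (a : ℕ → ℝ) {n : ℕ} (hn : n ≠ 0) (k : ℕ) :
    (narayanaTransformPoly a n).coeff k = narayanaNumber n k * a k := by
  simp only [narayanaTransformPoly, Polynomial.finsetSum_coeff, Polynomial.coeff_monomial]
  rw [Finset.sum_ite_eq']
  split_ifs with h
  · rfl
  · rw [Finset.mem_range] at h
    rw [narayanaNumber_eq_zero hn (by omega), zero_mul]

lemma CoeffNonneg.eval_one_nonneg {p : Polynomial ℝ} (hp : CoeffNonneg p) : 0 ≤ p.eval 1 := by
  rw [Polynomial.eval_eq_sum_range]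
  exact Finset.sum_nonneg fun i _ => by simpa using hp i

lemma coeffNonneg_narayanaTransformPoly {a : ℕ → ℝ} (hpos : ∀ k, 0 < a k)
    (ha : IsLogConvexSeq a) (n : ℕ) :
    CoeffNonneg (narayanaTransformPoly a (n + 3) * narayanaTransformPoly a (n + 1)
      - narayanaTransformPoly a (n + 2) * narayanaTransformPoly a (n + 2)) := by
  intro r
  -- Symmetrizing a sum over an antidiagonal with a symmetric factor doubles it.
  have symm : ∀ w : ℕ → ℕ → ℝ, (∀ k j, w k j = w j k) →
      ∑ x ∈ antidiagonal r, narayanaGap n x.1 x.2 * w x.1 x.2 =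
        2 * ∑ x ∈ antidiagonal r,
          (narayanaNumber (n + 3) x.1 * narayanaNumber (n + 1) x.2
            - narayanaNumber (n + 2) x.1 * narayanaNumber (n + 2) x.2) * w x.1 x.2 := by
    intro w hw
    have hswap := Finset.Nat.sum_antidiagonal_swap (n := r) (f := fun x : ℕ × ℕ =>
      (narayanaNumber (n + 3) x.1 * narayanaNumber (n + 1) x.2
        - narayanaNumber (n + 2) x.1 * narayanaNumber (n + 2) x.2) * w x.1 x.2)
    rw [two_mul]
    nth_rewrite 1 [← hswap]
    rw [← Finset.sum_add_distrib]
    refine Finset.sum_congr rfl fun x _ => ?_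
    simp only [Prod.fst_swap, Prod.snd_swap]
    rw [narayanaGap, hw x.2 x.1]
    ring
  have h0 := symm (fun _ _ => 1) fun _ _ => rfl
  simp only [mul_one] at h0
  have h1 := ha.sum_antidiagonal_nonneg hpos (narayanaGap n) (narayanaGap_comm n)
    (fun _ _ _ _ => narayanaGap_nonpos_of_neg) r
    (by rw [h0]; exact mul_nonneg zero_le_two (narayanaPoly_coeff_nonneg n r))
  rw [symm (fun k j => a k * a j) fun k j => mul_comm _ _] at h1
  rw [Polynomial.coeff_sub, Polynomial.coeff_mul, Polynomial.coeff_mul, ← Finset.sum_sub_distrib]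
  refine (nonneg_of_mul_nonneg_right h1 zero_lt_two).trans_eq (Finset.sum_congr rfl fun x _ => ?_)
  simp only [narayanaTransformPoly_coeff a (Nat.succ_ne_zero _)]
  ring

theorem mainTheorem3 (a : ℕ → ℝ) (ha_pos : ∀ k : ℕ, 0 < a k) (ha : IsLogConvexSeq a) :
    IsLogConvexSeq (narayanaTransform a) := by
  intro m hm
  rcases hm.eq_or_lt with rfl | hm
  · have h : 0 < a 0 * a 1 := mul_pos (ha_pos 0) (ha_pos 1)
    simp [narayanaTransform, narayanaNumber, Finset.sum_range_succ, Nat.choose]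
    nlinarith
  · obtain ⟨n, rfl⟩ : ∃ n, m = n + 2 := ⟨m - 2, by omega⟩
    have h := (coeffNonneg_narayanaTransformPoly ha_pos ha n).eval_one_nonneg
    rw [Polynomial.eval_sub, Polynomial.eval_mul, Polynomial.eval_mul] at h
    simp only [narayanaTransformPoly_eval] at h
    rw [show n + 2 + 1 = n + 3 by ring, show n + 2 - 1 = n + 1 by omega]
    linarith [sq (narayanaTransform a (n + 2))]
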